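/- Let $C_N(l)$ be the set of $N\times N$ complex Hadamard matrices (entries of modulus $1$, rows pairwise orthogonal) all of whose entries are $l$-th roots of unity. Say that the pair $(N,l)$ is - excluded by the Lam–Leung obstruction if $N\notin p_1\mathbb N+\cdots+p_k\mathbb N$, where $p_1,\dots,p_k$ are the distinct prime divisors of $l$ and $\mathbb N=\{0,1,2,\dots\}$; - excluded by the Turyn obstruction if there are no $a_0,\dots,a_{l-1}\in\mathbb N$ with $\sum_i a_i=N$ and $\sum_{i,k=0}^{l-1}w^k a_i a_{i+k}=N$, where $w=e^{2\pi \mathrm{i}/l}$ and indices are taken modulo $l$. **Theorem 2.7.** Consider the following table. $$\begin{array}{|l|l|l|l|l|l|l|l|l|} \hline N\backslash l&2&3&4&5&6&7&8&9\\ \hline 2&\circ_t&\circ&\times&\circ&\circ_t&\circ&\times&\circ\\ \hline 3&\circ&\times&\circ&\circ&\times&\circ&\circ&\times\\ \hline 4&\times&\circ&\times&\circ&\times&\circ&\times&\circ\\ \hline 5&\circ&\circ&\circ&\times&\circ_t&\circ&\circ&\circ\\ \hline 6&\circ_t&\circ_t&\circ_t&\circ&\circ_t&\circ&&\circ_t\\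 \hline 7&\circ&\circ&\circ&\circ&&\times&\circ&\circ\\ \hline 8&\circ_t&\circ&\times&\circ&\circ_t&\circ&\times&\circ\\ \hline 9&\circ&\times&\circ&\circ&\times&\circ&\circ&\times\\ \hline \end{array}$$ For all $2\le N,l\le 9$, the cell $(N,l)$ contains 1. a cross $\times$ if and only if $C_N(l)$ contains a circulant matrix; 2. the symbol $\circ$ if and only if $(N,l)$ is excluded by the Lam–Leung obstruction; 3. the symbol $\circ_t$ if and only if $(N,l)$ is not excluded by the Lam–Leung obstruction, but is excluded by the Turyn obstruction; 4. nothing if and only if $(N,l)$ is excluded by neither of the two obstructions, and yet $C_N(l)$ contains no circulant matrix. -/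

import Mathlib

open scoped ComplexConjugate

/-- A complex Hadamard matrix: a square matrix whose entries are on the unit circle and whose
rows are pairwise orthogonal. -/
def IsComplexHadamard {N : ℕ} (H : Matrix (Fin N) (Fin N) ℂ) : Prop :=
  (∀ i j, ‖H i j‖ = 1) ∧ ∀ i j, i ≠ j → ∑ k, H i k * conj (H j k) = 0

/-- The Butson class `C_N(l)`: the `N × N` complex Hadamard matrices all of whose entries are
`l`-th roots of unity (not necessarily primitive). -/
def butsonClass (N l : ℕ) : Set (Matrix (Fin N) (Fin N) ℂ) :=
  {H | IsComplexHadamard H ∧ ∀ i j, H i j ^ l = 1}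

/-- The circulant matrices in `C_N(l)`. The indices of the matrices are taken modulo `N`. -/
def circulantButsonClass (N l : ℕ) : Set (Matrix (Fin N) (Fin N) ℂ) :=
  {H ∈ butsonClass N l | ∃ v : Fin N → ℂ, H = Matrix.circulant v}

/-- The Lam-Leung condition: `N ∈ p₁ℕ + ⋯ + p_kℕ`, where `p₁, …, p_k` are the distinct prime
divisors of `l`. The Lam-Leung obstruction rules out `(N, l)` when this fails. -/
def LamLeungCondition (N l : ℕ) : Prop :=
  ∃ c : ℕ → ℕ, N = ∑ p ∈ l.primeFactors, c p * p

/-- The Turyn condition: there are `a₀, …, a_{l-1} ∈ ℕ` with `∑ aᵢ = N` and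
`∑_{i,k} w ^ k aᵢ a_{i+k} = N`, where `w = e^{2πi/l}` and the indices are taken modulo `l`
(addition in `Fin l`). The Turyn obstruction rules out `(N, l)` when this fails. -/
def TurynCondition (N l : ℕ) : Prop :=
  ∃ a : Fin l → ℕ, ∑ i, a i = N ∧
    ∑ i : Fin l, ∑ k : Fin l,
      Complex.exp (2 * Real.pi * Complex.I / l) ^ (k : ℕ) * (a i : ℂ) * (a (i + k) : ℂ) = (N : ℂ)

/-- The possible contents of a cell of the table. -/
inductive TableSymbol
  /-- the symbol `∘` (Lam-Leung obstruction) -/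
  | o
  /-- the symbol `∘ₜ` (Turyn obstruction) -/
  | ot
  /-- a cross -/
  | x
  /-- a blank cell -/
  | b
  deriving DecidableEq

/-- The table. The rows correspond to `N = 2, …, 9` and the columns to `l = 2, …, 9`, so that
the entry `(i, j)` describes the pair `(N, l) = (i + 2, j + 2)`. -/
def circulantButsonTable : Matrix (Fin 8) (Fin 8) TableSymbol :=
  !![.ot, .o , .x , .o , .ot, .o , .x , .o ;
     .o , .x , .o , .o , .x , .o , .o , .x ;
     .x , .o , .x , .o , .x , .o , .x , .o ;
     .o , .o , .o , .x , .ot, .o , .o , .o ;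
     .ot, .ot, .ot, .o , .ot, .o , .b , .ot;
     .o , .o , .o , .o , .b , .x , .o , .o ;
     .ot, .o , .x , .o , .ot, .o , .x , .o ;
     .o , .x , .o , .o , .x , .o , .o , .x ]

/-! Up to a scalar, a circulant matrix in `C_N(l)` is a vector of powers of the primitive root `w`
whose autocorrelations at nonzero lags vanish (`IsPerfectExponent`). These are integer polynomial
relations in `w`, so they are multiples of the cyclotomic polynomial and survive at each of its
roots `g` in `ZMod p`. All nonexistence results follow from this transfer. For `l` a power of `p`,
the choice `g = 1` gives `p ∣ N`, which is the Lam-Leung obstruction; for `l = 6` that obstruction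
never applies, since 2 and 3 generate every `N ≥ 2`. The Turyn equation is transferred modulo 109
and refuted by finite search. The two blank cells, (7, 6) and (6, 8), satisfy both conditions; there
the autocorrelation equations themselves have no solution modulo 13 and 17 respectively. Crosses
come from explicit exponent vectors and from `C_N(l) ⊆ C_N(l')` for `l ∣ l'`. -/

open Polynomial in
/-- An integral polynomial relation satisfied by a complex primitive `l`-th root of unity holds at
every root of the `l`-th cyclotomic polynomial, in any commutative ring. -/
theorem aeval_eq_zero_of_isPrimitiveRoot {R : Type*} [CommRing R] {l : ℕ} (hl : 0 < l) {w : ℂ}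
    (hw : IsPrimitiveRoot w l) {g : R} (hg : (cyclotomic l R).eval g = 0) {P : ℤ[X]}
    (hP : aeval w P = 0) : aeval g P = 0 := by
  have hdvd : cyclotomic l ℤ ∣ P := by
    rw [cyclotomic_eq_minpoly hw hl]
    exact minpoly.isIntegrallyClosed_dvd (hw.isIntegral hl) hP
  refine aeval_eq_zero_of_dvd_aeval_eq_zero hdvd ?_
  rw [aeval_def, eval₂_eq_eval_map]
  simpa using hg

/-! ### Circulant Butson matrices as exponent vectors -/

/-- The standard primitive `l`-th root of unity. -/
noncomputable def stdRoot (l : ℕ) : ℂ := Complex.exp (2 * Real.pi * Complex.I / l)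

theorem stdRoot_isPrimitiveRoot (l : ℕ) [NeZero l] : IsPrimitiveRoot (stdRoot l) l :=
  Complex.isPrimitiveRoot_exp l (NeZero.ne l)

theorem add_sub_one_mul_self (n l : ℕ) [NeZero l] : n + (l - 1) * n = l * n := by
  obtain ⟨d, rfl⟩ := Nat.exists_eq_succ_of_ne_zero (NeZero.ne l)
  rw [Nat.succ_sub_one, Nat.succ_mul, add_comm]

/-- Replacing conjugation by the power `l - 1` keeps every expression a polynomial in the root, as
reduction modulo `p` requires. -/
theorem conj_eq_pow_of_pow_eq_one {z : ℂ} {l : ℕ} [NeZero l] (hz : z ^ l = 1) :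
    conj z = z ^ (l - 1) := by
  have h1 : z * conj z = 1 := by
    rw [Complex.mul_conj, Complex.normSq_eq_norm_sq,
      Complex.norm_eq_one_of_pow_eq_one hz (NeZero.ne l)]
    norm_num
  have h2 : z * z ^ (l - 1) = 1 := by
    rw [← pow_succ', Nat.sub_add_cancel (NeZero.one_le), hz]
  have hz0 : z ≠ 0 := left_ne_zero_of_mul_eq_one h1
  exact mul_left_cancel₀ hz0 (h1.trans h2.symm)

/-- The exponents of a vector of `l`-th roots of unity having vanishing periodic
autocorrelations. -/
def IsPerfectExponent {N : ℕ} (l : ℕ) (e : Fin N → ℕ) : Prop :=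
  ∀ k : Fin N, (k : ℕ) ≠ 0 → ∑ m, stdRoot l ^ (e m + (l - 1) * e (m + k)) = 0

theorem circulantButsonClass_nonempty_of_isPerfectExponent {N l : ℕ} [NeZero N] [NeZero l]
    {e : Fin N → ℕ} (he : IsPerfectExponent l e) : (circulantButsonClass N l).Nonempty := by
  have hw : stdRoot l ^ l = 1 := (stdRoot_isPrimitiveRoot l).pow_eq_one
  have hv : ∀ n : ℕ, (stdRoot l ^ n) ^ l = 1 := fun n => by rw [pow_right_comm, hw, one_pow]
  refine ⟨Matrix.circulant fun m => stdRoot l ^ e m, ⟨⟨fun i j => ?_, fun i j hij => ?_⟩,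
    fun i j => hv _⟩, _, rfl⟩
  · exact Complex.norm_eq_one_of_pow_eq_one (hv _) (NeZero.ne l)
  · rw [← he (j - i) (by
      rw [Ne, Fin.val_eq_zero_iff, sub_eq_zero]
      exact hij.symm), ← Equiv.sum_comp (Equiv.subLeft i)]
    refine Finset.sum_congr rfl fun k _ => ?_
    have hk : j - (i - k) = k + (j - i) := by abel
    simp only [Matrix.circulant_apply, Equiv.subLeft_apply]
    rw [sub_sub_cancel, hk, conj_eq_pow_of_pow_eq_one (hv _), ← pow_mul, ← pow_add, mul_comm (e _)]

/-- Multiplying the vector by the unimodular constant `conj (v 0)` leaves autocorrelations unchanged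
and normalizes the first exponent to 0, which shortens the later searches. -/
theorem exists_isPerfectExponent {N l : ℕ} [NeZero N] [NeZero l]
    (h : (circulantButsonClass N l).Nonempty) :
    ∃ e : Fin N → ℕ, (∀ m, e m < l) ∧ e 0 = 0 ∧ IsPerfectExponent l e := by
  obtain ⟨_, ⟨⟨hnorm, horth⟩, hpow⟩, v, rfl⟩ := h
  have hvl : ∀ m, v m ^ l = 1 := fun m => by simpa using hpow m 0
  have hv1 : ∀ m, v m * conj (v m) = 1 := fun m => by
    have := hnorm m 0
    simp only [Matrix.circulant_apply, sub_zero] at this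
    rw [Complex.mul_conj, Complex.normSq_eq_norm_sq, this]
    norm_num
  have hex : ∀ m, ∃ i < l, stdRoot l ^ i = v m * conj (v 0) := fun m =>
    (stdRoot_isPrimitiveRoot l).eq_pow_of_pow_eq_one (by
      rw [mul_pow, ← map_pow, hvl, hvl, map_one, one_mul])
  choose e hel he using hex
  have hw : stdRoot l ^ l = 1 := (stdRoot_isPrimitiveRoot l).pow_eq_one
  refine ⟨e, hel, ?_, fun k hk => ?_⟩
  · refine (stdRoot_isPrimitiveRoot l).pow_inj (hel 0) (NeZero.pos l) ?_
    rw [he, hv1, pow_zero]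
  · have h0 : (0 : Fin N) ≠ k := fun h => hk (by simp [← h])
    rw [← horth 0 k h0, ← Equiv.sum_comp (Equiv.subLeft (0 : Fin N))]
    refine Finset.sum_congr rfl fun m _ => ?_
    have hk : 0 - m + k = k - m := by abel
    simp only [Matrix.circulant_apply, Equiv.subLeft_apply]
    rw [hk, pow_add, mul_comm (l - 1), pow_mul,
      ← conj_eq_pow_of_pow_eq_one (by rw [pow_right_comm, hw, one_pow]), he, he, map_mul,
      Complex.conj_conj]
    linear_combination (v (0 - m) * conj (v (k - m))) * hv1 0

/-- The autocorrelations of a perfect exponent vector vanish after reduction to any ring. -/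
theorem IsPerfectExponent.sum_eq_zero {N l : ℕ} [NeZero l] {e : Fin N → ℕ}
    (he : IsPerfectExponent l e) {R : Type*} [CommRing R] {g : R}
    (hg : (Polynomial.cyclotomic l R).eval g = 0) {k : Fin N} (hk : (k : ℕ) ≠ 0) :
    ∑ m, g ^ (e m + (l - 1) * e (m + k)) = 0 := by
  have := aeval_eq_zero_of_isPrimitiveRoot (NeZero.pos l) (stdRoot_isPrimitiveRoot l) hg
    (P := ∑ m, Polynomial.X ^ (e m + (l - 1) * e (m + k))) (by simpa using he k hk)
  simpa using this

/-! ### The Lam-Leung and Turyn obstructions -/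

/-- The Lam-Leung obstruction for prime powers. -/
theorem dvd_of_circulantButsonClass_nonempty {N p n : ℕ} (hN : 2 ≤ N) (hp : p.Prime)
    (h : (circulantButsonClass N (p ^ (n + 1))).Nonempty) : p ∣ N := by
  have : Fact p.Prime := ⟨hp⟩
  have : NeZero N := ⟨by omega⟩
  obtain ⟨e, -, -, he⟩ := exists_isPerfectExponent h
  -- The cyclotomic polynomial of a power of `p` takes the value `p` at 1, so `g = 1` is a root
  -- modulo `p`. The lag-one autocorrelation then becomes a sum of `N` ones.
  have := he.sum_eq_zero (R := ZMod p) (g := 1)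
    (by rw [Polynomial.eval_one_cyclotomic_prime_pow, ZMod.natCast_self]) (k := ⟨1, hN⟩) one_ne_zero
  rw [← ZMod.natCast_eq_zero_iff]
  simpa using this

theorem lamLeungCondition_prime_pow_iff {N p n : ℕ} (hp : p.Prime) :
    LamLeungCondition N (p ^ (n + 1)) ↔ p ∣ N := by
  simp only [LamLeungCondition, Nat.primeFactors_prime_pow n.succ_ne_zero hp,
    Finset.sum_singleton]
  exact ⟨fun ⟨c, hc⟩ => ⟨c p, by rw [hc, mul_comm]⟩, fun ⟨d, hd⟩ => ⟨fun _ => d, by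
    rw [hd, mul_comm]⟩⟩

theorem lamLeungCondition_six {N : ℕ} (hN : 2 ≤ N) : LamLeungCondition N 6 := by
  have h6 : Nat.primeFactors 6 = {2, 3} := by
    rw [show 6 = 2 * 3 from rfl, Nat.primeFactors_mul two_ne_zero three_ne_zero,
      Nat.prime_two.primeFactors, Nat.prime_three.primeFactors]
    rfl
  -- One 3 corrects the parity; an odd `N ≥ 2` is at least 3, so the subtraction does not truncate.
  refine ⟨fun p => if p = 2 then (N - 3 * (N % 2)) / 2 else N % 2, ?_⟩
  rw [h6, Finset.sum_pair (by norm_num)]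
  simp
  omega

/-- With `A = ∑ aᵢ Xⁱ`, the double sum is `A(w) A(w⁻¹)`, the squared modulus of `A(w)`. -/
theorem turynCondition_iff {N l : ℕ} [NeZero l] :
    TurynCondition N l ↔ ∃ a : Fin l → ℕ, ∑ i, a i = N ∧
      (∑ i, (a i : ℂ) * stdRoot l ^ (i : ℕ)) *
        (∑ i, (a i : ℂ) * stdRoot l ^ ((l - 1) * (i : ℕ))) = N := by
  refine exists_congr fun a => and_congr_right fun _ => ?_
  suffices h : ∀ i : Fin l, ∑ k : Fin l, stdRoot l ^ (k : ℕ) * (a i : ℂ) * (a (i + k) : ℂ) =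
      (∑ j, (a j : ℂ) * stdRoot l ^ (j : ℕ)) * ((a i : ℂ) * stdRoot l ^ ((l - 1) * (i : ℕ))) by
    have h' := Finset.sum_congr (rfl : Finset.univ = Finset.univ) fun i _ => h i
    rw [← Finset.mul_sum] at h'
    rw [← h']
    rfl
  intro i
  rw [Finset.sum_mul]
  refine Fintype.sum_equiv (Equiv.addLeft i) _ _ fun k => ?_
  have hpow : stdRoot l ^ (k : ℕ) =
      stdRoot l ^ ((i + k : Fin l) : ℕ) * stdRoot l ^ ((l - 1) * (i : ℕ)) := by
    rw [← pow_add]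
    refine (stdRoot_isPrimitiveRoot l).isOfFinOrder (NeZero.ne l) |>.pow_eq_pow_iff_modEq.2 ?_
    rw [← (stdRoot_isPrimitiveRoot l).eq_orderOf]
    have h1 : ((i + k : Fin l) : ℕ) ≡ i + k [MOD l] := by
      rw [Fin.val_add]
      exact Nat.mod_modEq _ _
    refine ((h1.add_right _).trans ?_).symm
    have h2 : (i : ℕ) + k + (l - 1) * i = k + l * i := by
      rw [add_right_comm, add_sub_one_mul_self, add_comm]
    rw [h2]
    simp [Nat.ModEq]
  simp only [Equiv.coe_addLeft]
  rw [hpow]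
  ring

/-- The Turyn obstruction: the sum of a row of a circulant Butson matrix has square modulus `N`. -/
theorem turynCondition_of_circulantButsonClass_nonempty {N l : ℕ} [NeZero N] [NeZero l]
    (h : (circulantButsonClass N l).Nonempty) : TurynCondition N l := by
  obtain ⟨e, hel, -, he⟩ := exists_isPerfectExponent h
  have hsum : ∀ f : ℕ → ℂ, ∑ i : Fin l, ((Finset.univ.filter fun m => e m = i).card : ℂ) * f i =
      ∑ m, f (e m) := by
    intro f
    rw [← Finset.sum_fiberwise_of_maps_to (s := Finset.univ) (t := Finset.univ)
      (g := fun m => (⟨e m, hel m⟩ : Fin l)) fun _ _ => Finset.mem_univ _]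
    refine Finset.sum_congr rfl fun i _ => ?_
    rw [Finset.sum_congr rfl (g := fun _ => f i) fun m hm => by
      rw [← (Finset.mem_filter.1 hm).2], Finset.sum_const, nsmul_eq_mul]
    congr 4
    ext m
    simp [Fin.ext_iff]
  rw [turynCondition_iff]
  -- Here `aᵢ` counts the occurrences of `wⁱ` in the vector.
  refine ⟨fun i => (Finset.univ.filter fun m => e m = i).card, ?_, ?_⟩
  · have := hsum fun _ => 1
    simp only [mul_one, Finset.sum_const, Finset.card_univ, Fintype.card_fin, nsmul_eq_mul] at this
    exact_mod_cast this
  · rw [hsum fun n => stdRoot l ^ n, hsum fun n => stdRoot l ^ ((l - 1) * n), Finset.sum_mul_sum]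
    have : ∀ m : Fin N, ∑ m', stdRoot l ^ e m * stdRoot l ^ ((l - 1) * e m') =
        ∑ k, stdRoot l ^ (e m + (l - 1) * e (m + k)) := fun m => by
      rw [← Equiv.sum_comp (Equiv.addLeft m)]
      simp [pow_add]
    simp_rw [this]
    -- Grouped by lag, the squared modulus of the sum retains only lag 0, which contributes `N`.
    rw [Finset.sum_comm, Finset.sum_eq_single 0 (fun k _ hk => he k (by simpa using hk)) (by simp)]
    have hone : ∀ n, stdRoot l ^ (n + (l - 1) * n) = 1 := fun n => by
      rw [add_sub_one_mul_self, pow_mul, (stdRoot_isPrimitiveRoot l).pow_eq_one, one_pow]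
    simp [hone]

theorem not_turynCondition {N l : ℕ} [NeZero l] (p g : ℕ)
    (hg : (Polynomial.cyclotomic l (ZMod p)).eval (g : ZMod p) = 0)
    (h : ∀ a ∈ List.Nat.antidiagonalTuple l N,
      (∑ i, a i * g ^ (i : ℕ)) * (∑ i, a i * g ^ ((l - 1) * (i : ℕ))) % p ≠ N % p) :
    ¬ TurynCondition N l := by
  rw [turynCondition_iff]
  rintro ⟨a, ha, hN⟩
  refine h a (List.Nat.mem_antidiagonalTuple.2 ha) ?_
  have := aeval_eq_zero_of_isPrimitiveRoot (NeZero.pos l) (stdRoot_isPrimitiveRoot l) hg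
    (P := (∑ i, (a i : Polynomial ℤ) * Polynomial.X ^ (i : ℕ)) *
        (∑ i, (a i : Polynomial ℤ) * Polynomial.X ^ ((l - 1) * (i : ℕ))) - (N : Polynomial ℤ))
    (by simpa [sub_eq_zero] using hN)
  rw [map_sub, sub_eq_zero] at this
  refine (ZMod.natCast_eq_natCast_iff _ _ _).1 ?_
  push_cast
  simpa using this

theorem eval_cyclotomic_zmod_eq_zero {l p g : ℕ} [Fact p.Prime] (hl : 0 < l)
    (hg : g ^ l % p = 1 % p) (hlt : ∀ d < l, 0 < d → g ^ d % p ≠ 1 % p) :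
    (Polynomial.cyclotomic l (ZMod p)).eval (g : ZMod p) = 0 := by
  refine IsPrimitiveRoot.isRoot_cyclotomic hl (IsPrimitiveRoot.mk_of_lt _ hl ?_ fun d hd hdl h => ?_)
  · exact_mod_cast (ZMod.natCast_eq_natCast_iff (g ^ l) 1 p).2 hg
  · refine hlt d hdl hd ((ZMod.natCast_eq_natCast_iff (g ^ d) 1 p).1 ?_)
    exact_mod_cast h

/-! ### Explicit circulant matrices -/

/-- A sum of powers of a primitive `l`-th root of unity vanishes if the exponents are invariant
modulo `l` under some translation which is nontrivial modulo `l`. -/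
theorem sum_pow_eq_zero_of_translation_invariant {ι : Type*} [Fintype ι] {l : ℕ} {w : ℂ}
    (hw : IsPrimitiveRoot w l) {f : ι → ℕ} {t : ℕ} (ht : 0 < t) (htl : t < l)
    (h : Finset.univ.val.map (fun m => (f m + t) % l) = Finset.univ.val.map fun m => f m % l) :
    ∑ m, w ^ f m = 0 := by
  have hmod : ∀ n, w ^ (n % l) = w ^ n := fun n => (pow_eq_pow_mod n hw.pow_eq_one).symm
  have h' := congrArg (fun s => (s.map fun n => w ^ n).sum) h
  simp only [Multiset.map_map, Function.comp_def, hmod, pow_add] at h'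
  change ∑ m, w ^ f m * w ^ t = ∑ m, w ^ f m at h'
  rw [← Finset.sum_mul] at h'
  have h1 : w ^ t - 1 ≠ 0 := sub_ne_zero.2 (hw.pow_ne_one_of_pos_of_lt ht.ne' htl)
  exact (mul_eq_zero.1 (by linear_combination h')).resolve_right h1

/-- Reduces the vanishing of complex sums to equalities of multisets of residues, which are
decidable. -/
theorem isPerfectExponent_of_translation_invariant {N l : ℕ} [NeZero l] {e : Fin N → ℕ} (t : ℕ)
    (ht : 0 < t ∧ t < l)
    (h : ∀ k : Fin N, (k : ℕ) ≠ 0 →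
      Finset.univ.val.map (fun m => (e m + (l - 1) * e (m + k) + t) % l) =
        Finset.univ.val.map fun m => (e m + (l - 1) * e (m + k)) % l) :
    IsPerfectExponent l e := fun k hk =>
  sum_pow_eq_zero_of_translation_invariant (stdRoot_isPrimitiveRoot l) ht.1 ht.2 (h k hk)

theorem circulantButsonClass_mono {N l l' : ℕ} (h : l ∣ l')
    (hne : (circulantButsonClass N l).Nonempty) : (circulantButsonClass N l').Nonempty := by
  obtain ⟨H, ⟨hH, hl⟩, hv⟩ := hne
  obtain ⟨d, rfl⟩ := h
  exact ⟨H, ⟨hH, fun i j => by rw [pow_mul, hl, one_pow]⟩, hv⟩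

theorem circulantButsonClass_two_four : (circulantButsonClass 2 4).Nonempty :=
  circulantButsonClass_nonempty_of_isPerfectExponent (e := ![0, 1])
    (isPerfectExponent_of_translation_invariant 2 (by decide) (by decide))

theorem circulantButsonClass_three_three : (circulantButsonClass 3 3).Nonempty :=
  circulantButsonClass_nonempty_of_isPerfectExponent (e := ![0, 0, 1])
    (isPerfectExponent_of_translation_invariant 1 (by decide) (by decide))

theorem circulantButsonClass_four_two : (circulantButsonClass 4 2).Nonempty :=
  circulantButsonClass_nonempty_of_isPerfectExponent (e := ![0, 0, 0, 1])
    (isPerfectExponent_of_translation_invariant 1 (by decide) (by decide))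

theorem circulantButsonClass_five_five : (circulantButsonClass 5 5).Nonempty :=
  circulantButsonClass_nonempty_of_isPerfectExponent (e := ![0, 0, 1, 3, 1])
    (isPerfectExponent_of_translation_invariant 1 (by decide) (by decide +kernel))

theorem circulantButsonClass_seven_seven : (circulantButsonClass 7 7).Nonempty :=
  -- Triangular numbers `m(m-1)/2` modulo 5, as also for 3 and 7: their differences at a nonzero lag
  -- are affine in `m` with invertible slope, hence run over all residues.
  circulantButsonClass_nonempty_of_isPerfectExponent (e := ![0, 0, 1, 3, 6, 3, 1])
    (isPerfectExponent_of_translation_invariant 1 (by decide) (by decide +kernel))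

theorem circulantButsonClass_eight_four : (circulantButsonClass 8 4).Nonempty :=
  circulantButsonClass_nonempty_of_isPerfectExponent (e := ![0, 0, 0, 1, 2, 0, 2, 1])
    (isPerfectExponent_of_translation_invariant 2 (by decide) (by decide +kernel))

theorem circulantButsonClass_nine_three : (circulantButsonClass 9 3).Nonempty :=
  -- The entry at `3a + b` is `ab` modulo 3.
  circulantButsonClass_nonempty_of_isPerfectExponent (e := ![0, 0, 0, 0, 1, 2, 0, 2, 1])
    (isPerfectExponent_of_translation_invariant 1 (by decide) (by decide +kernel))

/-! ### The Turyn condition: solutions and refutations -/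

theorem turynCondition_six_eight : TurynCondition 6 8 := by
  have h4 : stdRoot 8 ^ 4 = -1 := by
    have h := (stdRoot_isPrimitiveRoot 8).isRoot_cyclotomic (by norm_num)
    rw [show 8 = 2 ^ (2 + 1) from rfl, Polynomial.cyclotomic_prime_pow_eq_geom_sum Nat.prime_two]
      at h
    simp [Finset.sum_range_succ] at h
    linear_combination h
  -- The sum is `3 + w + w³ + w⁴ = 2 + i√2`, of squared modulus 6.
  refine turynCondition_iff.2 ⟨![3, 1, 0, 1, 1, 0, 0, 0], by decide, ?_⟩
  simp only [Fin.sum_univ_succ, Fin.sum_univ_zero]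
  simp
  generalize stdRoot 8 = w at h4
  have h7 : w ^ 7 = -w ^ 3 := by linear_combination w ^ 3 * h4
  have h21 : w ^ 21 = -w := by linear_combination (w ^ 17 - w ^ 13 + w ^ 9 - w ^ 5 + w) * h4
  have h28 : w ^ 28 = -1 := by
    linear_combination (w ^ 24 - w ^ 20 + w ^ 16 - w ^ 12 + w ^ 8 - w ^ 4 + 1) * h4
  rw [h4, h7, h21, h28]
  linear_combination (-w ^ 2 - 2) * h4

theorem turynCondition_seven_six : TurynCondition 7 6 := by
  have h2 : stdRoot 6 ^ 2 = stdRoot 6 - 1 := by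
    have h := (stdRoot_isPrimitiveRoot 6).isRoot_cyclotomic (by norm_num)
    rw [Polynomial.cyclotomic_six] at h
    simp at h
    linear_combination h
  -- The sum is `4 + 2w³ + w⁵ = 2 + conj w`, of squared modulus 7.
  refine turynCondition_iff.2 ⟨![4, 0, 0, 2, 0, 1], by decide, ?_⟩
  simp only [Fin.sum_univ_succ, Fin.sum_univ_zero]
  simp
  generalize stdRoot 6 = w at h2
  have h3 : w ^ 3 = -1 := by linear_combination (w + 1) * h2
  have h5 : w ^ 5 = 1 - w := by linear_combination w ^ 2 * h3 - h2
  have h15 : w ^ 15 = -1 := by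
    linear_combination (w ^ 12 - w ^ 9 + w ^ 6 - w ^ 3 + 1) * h3
  have h25 : w ^ 25 = w := by
    linear_combination (w ^ 22 - w ^ 19 + w ^ 16 - w ^ 13 + w ^ 10 - w ^ 7 + w ^ 4 - w) * h3
  rw [h3, h5, h15, h25]
  linear_combination -h2

/-- A primitive `l`-th root exists modulo `p` when `l ∣ p - 1`: 13 serves `l = 6`, 17 serves `l =
8`, and 109 serves `l = 2, 3, 4, 6, 9`. -/
instance fact_prime_thirteen : Fact (Nat.Prime 13) := ⟨by norm_num⟩

instance fact_prime_seventeen : Fact (Nat.Prime 17) := ⟨by norm_num⟩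

instance fact_prime_one_hundred_nine : Fact (Nat.Prime 109) := ⟨by norm_num⟩

theorem not_turynCondition_two_two : ¬ TurynCondition 2 2 :=
  not_turynCondition 109 108 (eval_cyclotomic_zmod_eq_zero (by decide) (by decide) (by decide))
    (by decide +kernel)

theorem not_turynCondition_six_two : ¬ TurynCondition 6 2 :=
  not_turynCondition 109 108 (eval_cyclotomic_zmod_eq_zero (by decide) (by decide) (by decide))
    (by decide +kernel)

theorem not_turynCondition_eight_two : ¬ TurynCondition 8 2 :=
  not_turynCondition 109 108 (eval_cyclotomic_zmod_eq_zero (by decide) (by decide) (by decide))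
    (by decide +kernel)

theorem not_turynCondition_six_three : ¬ TurynCondition 6 3 :=
  not_turynCondition 109 45 (eval_cyclotomic_zmod_eq_zero (by decide) (by decide) (by decide))
    (by decide +kernel)

theorem not_turynCondition_six_four : ¬ TurynCondition 6 4 :=
  not_turynCondition 109 33 (eval_cyclotomic_zmod_eq_zero (by decide) (by decide) (by decide))
    (by decide +kernel)

theorem not_turynCondition_two_six : ¬ TurynCondition 2 6 :=
  not_turynCondition 109 46 (eval_cyclotomic_zmod_eq_zero (by decide) (by decide) (by decide))
    (by decide +kernel)

theorem not_turynCondition_five_six : ¬ TurynCondition 5 6 :=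
  not_turynCondition 109 46 (eval_cyclotomic_zmod_eq_zero (by decide) (by decide) (by decide))
    (by decide +kernel)

theorem not_turynCondition_six_six : ¬ TurynCondition 6 6 :=
  not_turynCondition 109 46 (eval_cyclotomic_zmod_eq_zero (by decide) (by decide) (by decide))
    (by decide +kernel)

theorem not_turynCondition_eight_six : ¬ TurynCondition 8 6 :=
  not_turynCondition 109 46 (eval_cyclotomic_zmod_eq_zero (by decide) (by decide) (by decide))
    (by decide +kernel)

theorem not_turynCondition_six_nine : ¬ TurynCondition 6 9 :=
  not_turynCondition 109 16 (eval_cyclotomic_zmod_eq_zero (by decide) (by decide) (by decide))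
    (by decide +kernel)

/-! ### The two blank cells -/

/-- A circulant matrix in `C_N(l)` gives residues modulo `p`, powers of an `l`-th root of unity,
whose periodic autocorrelations vanish. -/
theorem exists_perfect_residues {N l p g : ℕ} [NeZero N] [NeZero l] [Fact p.Prime]
    (hg : (Polynomial.cyclotomic l (ZMod p)).eval (g : ZMod p) = 0)
    (h : (circulantButsonClass N l).Nonempty) :
    ∃ u : Fin N → ℕ, (∀ m, u m ∈ (List.range l).map fun n => g ^ n % p) ∧ u 0 = 1 ∧
      ∀ k : Fin N, (k : ℕ) ≠ 0 → (∑ m, u m * u (m + k) ^ (l - 1)) % p = 0 := by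
  obtain ⟨e, hel, he0, he⟩ := exists_isPerfectExponent h
  refine ⟨fun m => g ^ e m % p, fun m => List.mem_map.2 ⟨e m, List.mem_range.2 (hel m), rfl⟩,
    by simp [he0, Nat.mod_eq_of_lt (Fact.out : p.Prime).one_lt], fun k hk => ?_⟩
  rw [← Nat.dvd_iff_mod_eq_zero, ← ZMod.natCast_eq_zero_iff, ← he.sum_eq_zero hg hk]
  push_cast
  refine Finset.sum_congr rfl fun m _ => ?_
  simp only [ZMod.natCast_mod, Nat.cast_pow]
  rw [← pow_mul, ← pow_add, mul_comm (e _)]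

/-- The list holds the powers of 4 modulo 13, and fifth powers are inverses. Lags `k` and `-k` are
conjugate over `ℂ` but give separate congruences modulo 13, so all six are used. -/
theorem no_perfect_residues_seven_six :
    ∀ b ∈ [1, 4, 3, 12, 9, 10],
    ∀ c ∈ [1, 4, 3, 12, 9, 10],
    ∀ d ∈ [1, 4, 3, 12, 9, 10],
    ∀ e ∈ [1, 4, 3, 12, 9, 10],
    ∀ f ∈ [1, 4, 3, 12, 9, 10],
    ∀ g ∈ [1, 4, 3, 12, 9, 10],
    (1 * b ^ 5 + b * c ^ 5 + c * d ^ 5 + d * e ^ 5 + e * f ^ 5 + f * g ^ 5 + g * 1 ^ 5) % 13 = 0 →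
    (1 * c ^ 5 + b * d ^ 5 + c * e ^ 5 + d * f ^ 5 + e * g ^ 5 + f * 1 ^ 5 + g * b ^ 5) % 13 = 0 →
    (1 * d ^ 5 + b * e ^ 5 + c * f ^ 5 + d * g ^ 5 + e * 1 ^ 5 + f * b ^ 5 + g * c ^ 5) % 13 = 0 →
    (1 * e ^ 5 + b * f ^ 5 + c * g ^ 5 + d * 1 ^ 5 + e * b ^ 5 + f * c ^ 5 + g * d ^ 5) % 13 = 0 →
    (1 * f ^ 5 + b * g ^ 5 + c * 1 ^ 5 + d * b ^ 5 + e * c ^ 5 + f * d ^ 5 + g * e ^ 5) % 13 = 0 →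
    (1 * g ^ 5 + b * 1 ^ 5 + c * b ^ 5 + d * c ^ 5 + e * d ^ 5 + f * e ^ 5 + g * f ^ 5) % 13 ≠ 0 := by
  decide +kernel

theorem not_nonempty_circulantButsonClass_seven_six : ¬ (circulantButsonClass 7 6).Nonempty := by
  intro h
  obtain ⟨u, hu, hu0, H⟩ := exists_perfect_residues (p := 13) (g := 4)
    (eval_cyclotomic_zmod_eq_zero (by decide) (by decide) (by decide)) h
  replace hu : ∀ m, u m ∈ [1, 4, 3, 12, 9, 10] := hu
  refine no_perfect_residues_seven_six _ (hu 1) _ (hu 2) _ (hu 3) _ (hu 4) _ (hu 5) _ (hu 6)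
    (by simpa [Fin.sum_univ_seven, hu0] using H 1 (by decide))
    (by simpa [Fin.sum_univ_seven, hu0] using H 2 (by decide))
    (by simpa [Fin.sum_univ_seven, hu0] using H 3 (by decide))
    (by simpa [Fin.sum_univ_seven, hu0] using H 4 (by decide))
    (by simpa [Fin.sum_univ_seven, hu0] using H 5 (by decide))
    (by simpa [Fin.sum_univ_seven, hu0] using H 6 (by decide))

/-- The list holds the powers of 2 modulo 17, where seventh powers are inverses. -/
theorem no_perfect_residues_six_eight :
    ∀ b ∈ [1, 2, 4, 8, 16, 15, 13, 9],
    ∀ c ∈ [1, 2, 4, 8, 16, 15, 13, 9],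
    ∀ d ∈ [1, 2, 4, 8, 16, 15, 13, 9],
    ∀ e ∈ [1, 2, 4, 8, 16, 15, 13, 9],
    ∀ f ∈ [1, 2, 4, 8, 16, 15, 13, 9],
    (1 * b ^ 7 + b * c ^ 7 + c * d ^ 7 + d * e ^ 7 + e * f ^ 7 + f * 1 ^ 7) % 17 = 0 →
    (1 * c ^ 7 + b * d ^ 7 + c * e ^ 7 + d * f ^ 7 + e * 1 ^ 7 + f * b ^ 7) % 17 = 0 →
    (1 * d ^ 7 + b * e ^ 7 + c * f ^ 7 + d * 1 ^ 7 + e * b ^ 7 + f * c ^ 7) % 17 = 0 →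
    (1 * e ^ 7 + b * f ^ 7 + c * 1 ^ 7 + d * b ^ 7 + e * c ^ 7 + f * d ^ 7) % 17 = 0 →
    (1 * f ^ 7 + b * 1 ^ 7 + c * b ^ 7 + d * c ^ 7 + e * d ^ 7 + f * e ^ 7) % 17 ≠ 0 := by
  decide +kernel

theorem not_nonempty_circulantButsonClass_six_eight : ¬ (circulantButsonClass 6 8).Nonempty := by
  intro h
  obtain ⟨u, hu, hu0, H⟩ := exists_perfect_residues (p := 17) (g := 2)
    (eval_cyclotomic_zmod_eq_zero (by decide) (by decide) (by decide)) h
  replace hu : ∀ m, u m ∈ [1, 2, 4, 8, 16, 15, 13, 9] := hu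
  refine no_perfect_residues_six_eight _ (hu 1) _ (hu 2) _ (hu 3) _ (hu 4) _ (hu 5)
    (by simpa [Fin.sum_univ_six, hu0] using H 1 (by decide))
    (by simpa [Fin.sum_univ_six, hu0] using H 2 (by decide))
    (by simpa [Fin.sum_univ_six, hu0] using H 3 (by decide))
    (by simpa [Fin.sum_univ_six, hu0] using H 4 (by decide))
    (by simpa [Fin.sum_univ_six, hu0] using H 5 (by decide))

/-! ### Assembling the table by columns -/

/-- The assertion that the symbol `s` is the correct content of the cell `(N, l)`. -/
def IsCellContent (s : TableSymbol) (N l : ℕ) : Prop :=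
  (s = .x ↔ (circulantButsonClass N l).Nonempty) ∧
  (s = .o ↔ ¬ LamLeungCondition N l) ∧
  (s = .ot ↔ LamLeungCondition N l ∧ ¬ TurynCondition N l) ∧
  (s = .b ↔ LamLeungCondition N l ∧ TurynCondition N l ∧ ¬ (circulantButsonClass N l).Nonempty)

/-- Existence already forces the Turyn condition, so the other three symbols are excluded. -/
theorem isCellContent_x {N l : ℕ} [NeZero N] [NeZero l] (hL : LamLeungCondition N l)
    (h : (circulantButsonClass N l).Nonempty) : IsCellContent .x N l := by
  simp [IsCellContent, h, hL, turynCondition_of_circulantButsonClass_nonempty h]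

theorem isCellContent_o {N : ℕ} (p n : ℕ) (hN : 2 ≤ N) (hp : p.Prime) (h : ¬ p ∣ N) :
    IsCellContent .o N (p ^ (n + 1)) := by
  have hC : ¬ (circulantButsonClass N (p ^ (n + 1))).Nonempty := fun hC =>
    h (dvd_of_circulantButsonClass_nonempty hN hp hC)
  simp [IsCellContent, hC, lamLeungCondition_prime_pow_iff hp, h]

theorem isCellContent_ot {N l : ℕ} [NeZero N] [NeZero l] (hL : LamLeungCondition N l)
    (h : ¬ TurynCondition N l) : IsCellContent .ot N l := by
  have hC := mt turynCondition_of_circulantButsonClass_nonempty h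
  simp [IsCellContent, h, hL, hC]

theorem isCellContent_b {N l : ℕ} (hL : LamLeungCondition N l) (hT : TurynCondition N l)
    (h : ¬ (circulantButsonClass N l).Nonempty) : IsCellContent .b N l := by
  simp [IsCellContent, h, hL, hT]

theorem lamLeungCondition_prime_pow {N p n : ℕ} (hp : p.Prime) (h : p ∣ N) :
    LamLeungCondition N (p ^ (n + 1)) := (lamLeungCondition_prime_pow_iff hp).2 h

theorem isCellContent_column_two (i : Fin 8) :
    IsCellContent (circulantButsonTable i 0) (i + 2) 2 := by
  have hL : ∀ N, 2 ∣ N → LamLeungCondition N 2 := fun N h =>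
    lamLeungCondition_prime_pow (n := 0) Nat.prime_two h
  have ho : ∀ N, 2 ≤ N → ¬ 2 ∣ N → IsCellContent .o N 2 := fun N hN h =>
    isCellContent_o 2 0 hN Nat.prime_two h
  fin_cases i
  · exact isCellContent_ot (hL 2 (by norm_num))
      not_turynCondition_two_two
  · exact ho 3 (by norm_num) (by norm_num)
  · exact isCellContent_x (hL 4 (by norm_num))
      circulantButsonClass_four_two
  · exact ho 5 (by norm_num) (by norm_num)
  · exact isCellContent_ot (hL 6 (by norm_num))
      not_turynCondition_six_two
  · exact ho 7 (by norm_num) (by norm_num)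
  · exact isCellContent_ot (hL 8 (by norm_num))
      not_turynCondition_eight_two
  · exact ho 9 (by norm_num) (by norm_num)

theorem isCellContent_column_three (i : Fin 8) :
    IsCellContent (circulantButsonTable i 1) (i + 2) 3 := by
  have hL : ∀ N, 3 ∣ N → LamLeungCondition N 3 := fun N h =>
    lamLeungCondition_prime_pow (n := 0) Nat.prime_three h
  have ho : ∀ N, 2 ≤ N → ¬ 3 ∣ N → IsCellContent .o N 3 := fun N hN h =>
    isCellContent_o 3 0 hN Nat.prime_three h
  fin_cases i
  · exact ho 2 (by norm_num) (by norm_num)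
  · exact isCellContent_x (hL 3 (by norm_num))
      circulantButsonClass_three_three
  · exact ho 4 (by norm_num) (by norm_num)
  · exact ho 5 (by norm_num) (by norm_num)
  · exact isCellContent_ot (hL 6 (by norm_num))
      not_turynCondition_six_three
  · exact ho 7 (by norm_num) (by norm_num)
  · exact ho 8 (by norm_num) (by norm_num)
  · exact isCellContent_x (hL 9 (by norm_num))
      circulantButsonClass_nine_three

theorem isCellContent_column_four (i : Fin 8) :
    IsCellContent (circulantButsonTable i 2) (i + 2) 4 := by
  have hL : ∀ N, 2 ∣ N → LamLeungCondition N 4 := fun N h =>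
    lamLeungCondition_prime_pow (n := 1) Nat.prime_two h
  have ho : ∀ N, 2 ≤ N → ¬ 2 ∣ N → IsCellContent .o N 4 := fun N hN h =>
    isCellContent_o 2 1 hN Nat.prime_two h
  fin_cases i
  · exact isCellContent_x (hL 2 (by norm_num))
      circulantButsonClass_two_four
  · exact ho 3 (by norm_num) (by norm_num)
  · exact isCellContent_x (hL 4 (by norm_num))
      (circulantButsonClass_mono (by norm_num) circulantButsonClass_four_two)
  · exact ho 5 (by norm_num) (by norm_num)
  · exact isCellContent_ot (hL 6 (by norm_num))
      not_turynCondition_six_four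
  · exact ho 7 (by norm_num) (by norm_num)
  · exact isCellContent_x (hL 8 (by norm_num))
      circulantButsonClass_eight_four
  · exact ho 9 (by norm_num) (by norm_num)

theorem isCellContent_column_five (i : Fin 8) :
    IsCellContent (circulantButsonTable i 3) (i + 2) 5 := by
  have hL : ∀ N, 5 ∣ N → LamLeungCondition N 5 := fun N h =>
    lamLeungCondition_prime_pow (n := 0) Nat.prime_five h
  have ho : ∀ N, 2 ≤ N → ¬ 5 ∣ N → IsCellContent .o N 5 := fun N hN h =>
    isCellContent_o 5 0 hN Nat.prime_five h
  fin_cases i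
  · exact ho 2 (by norm_num) (by norm_num)
  · exact ho 3 (by norm_num) (by norm_num)
  · exact ho 4 (by norm_num) (by norm_num)
  · exact isCellContent_x (hL 5 (by norm_num))
      circulantButsonClass_five_five
  · exact ho 6 (by norm_num) (by norm_num)
  · exact ho 7 (by norm_num) (by norm_num)
  · exact ho 8 (by norm_num) (by norm_num)
  · exact ho 9 (by norm_num) (by norm_num)

theorem isCellContent_column_six (i : Fin 8) :
    IsCellContent (circulantButsonTable i 4) (i + 2) 6 := by
  fin_cases i
  · exact isCellContent_ot (lamLeungCondition_six (by norm_num))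
      not_turynCondition_two_six
  · exact isCellContent_x (lamLeungCondition_six (by norm_num))
      (circulantButsonClass_mono (by norm_num) circulantButsonClass_three_three)
  · exact isCellContent_x (lamLeungCondition_six (by norm_num))
      (circulantButsonClass_mono (by norm_num) circulantButsonClass_four_two)
  · exact isCellContent_ot (lamLeungCondition_six (by norm_num))
      not_turynCondition_five_six
  · exact isCellContent_ot (lamLeungCondition_six (by norm_num))
      not_turynCondition_six_six
  · exact isCellContent_b (lamLeungCondition_six (by norm_num))
      turynCondition_seven_six not_nonempty_circulantButsonClass_seven_six
  · exact isCellContent_ot (lamLeungCondition_six (by norm_num))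
      not_turynCondition_eight_six
  · exact isCellContent_x (lamLeungCondition_six (by norm_num))
      (circulantButsonClass_mono (by norm_num) circulantButsonClass_nine_three)

theorem isCellContent_column_seven (i : Fin 8) :
    IsCellContent (circulantButsonTable i 5) (i + 2) 7 := by
  have hL : ∀ N, 7 ∣ N → LamLeungCondition N 7 := fun N h =>
    lamLeungCondition_prime_pow (n := 0) Nat.prime_seven h
  have ho : ∀ N, 2 ≤ N → ¬ 7 ∣ N → IsCellContent .o N 7 := fun N hN h =>
    isCellContent_o 7 0 hN Nat.prime_seven h
  fin_cases i
  · exact ho 2 (by norm_num) (by norm_num)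
  · exact ho 3 (by norm_num) (by norm_num)
  · exact ho 4 (by norm_num) (by norm_num)
  · exact ho 5 (by norm_num) (by norm_num)
  · exact ho 6 (by norm_num) (by norm_num)
  · exact isCellContent_x (hL 7 (by norm_num))
      circulantButsonClass_seven_seven
  · exact ho 8 (by norm_num) (by norm_num)
  · exact ho 9 (by norm_num) (by norm_num)

theorem isCellContent_column_eight (i : Fin 8) :
    IsCellContent (circulantButsonTable i 6) (i + 2) 8 := by
  have hL : ∀ N, 2 ∣ N → LamLeungCondition N 8 := fun N h =>
    lamLeungCondition_prime_pow (n := 2) Nat.prime_two h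
  have ho : ∀ N, 2 ≤ N → ¬ 2 ∣ N → IsCellContent .o N 8 := fun N hN h =>
    isCellContent_o 2 2 hN Nat.prime_two h
  fin_cases i
  · exact isCellContent_x (hL 2 (by norm_num))
      (circulantButsonClass_mono (by norm_num) circulantButsonClass_two_four)
  · exact ho 3 (by norm_num) (by norm_num)
  · exact isCellContent_x (hL 4 (by norm_num))
      (circulantButsonClass_mono (by norm_num) circulantButsonClass_four_two)
  · exact ho 5 (by norm_num) (by norm_num)
  · exact isCellContent_b (hL 6 (by norm_num))
      turynCondition_six_eight not_nonempty_circulantButsonClass_six_eight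
  · exact ho 7 (by norm_num) (by norm_num)
  · exact isCellContent_x (hL 8 (by norm_num))
      (circulantButsonClass_mono (by norm_num) circulantButsonClass_eight_four)
  · exact ho 9 (by norm_num) (by norm_num)

theorem isCellContent_column_nine (i : Fin 8) :
    IsCellContent (circulantButsonTable i 7) (i + 2) 9 := by
  have hL : ∀ N, 3 ∣ N → LamLeungCondition N 9 := fun N h =>
    lamLeungCondition_prime_pow (n := 1) Nat.prime_three h
  have ho : ∀ N, 2 ≤ N → ¬ 3 ∣ N → IsCellContent .o N 9 := fun N hN h =>
    isCellContent_o 3 1 hN Nat.prime_three h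
  fin_cases i
  · exact ho 2 (by norm_num) (by norm_num)
  · exact isCellContent_x (hL 3 (by norm_num))
      (circulantButsonClass_mono (by norm_num) circulantButsonClass_three_three)
  · exact ho 4 (by norm_num) (by norm_num)
  · exact ho 5 (by norm_num) (by norm_num)
  · exact isCellContent_ot (hL 6 (by norm_num))
      not_turynCondition_six_nine
  · exact ho 7 (by norm_num) (by norm_num)
  · exact ho 8 (by norm_num) (by norm_num)
  · exact isCellContent_x (hL 9 (by norm_num))
      (circulantButsonClass_mono (by norm_num) circulantButsonClass_nine_three)

/-- For `2 ≤ N, l ≤ 9`, the table shows a cross exactly when `C_N(l)` contains a circulant matrix,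
`∘` exactly when the Lam-Leung obstruction applies, `∘ₜ` exactly when the Lam-Leung obstruction
does not apply but the Turyn obstruction does, and a blank exactly when neither obstruction
applies and yet there is no circulant matrix in `C_N(l)`. -/
theorem theorem2p7 (N l : ℕ) (i j : Fin 8) (hN : N = (i : ℕ) + 2) (hl : l = (j : ℕ) + 2) :
    (circulantButsonTable i j = .x ↔ (circulantButsonClass N l).Nonempty) ∧
    (circulantButsonTable i j = .o ↔ ¬ LamLeungCondition N l) ∧
    (circulantButsonTable i j = .ot ↔ LamLeungCondition N l ∧ ¬ TurynCondition N l) ∧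
    (circulantButsonTable i j = .b ↔
      LamLeungCondition N l ∧ TurynCondition N l ∧ ¬ (circulantButsonClass N l).Nonempty) := by
  subst hN hl
  change IsCellContent (circulantButsonTable i j) (i + 2) (j + 2)
  fin_cases j
  · exact isCellContent_column_two i
  · exact isCellContent_column_three i
  · exact isCellContent_column_four i
  · exact isCellContent_column_five i
  · exact isCellContent_column_six i
  · exact isCellContent_column_seven i
  · exact isCellContent_column_eight i
  · exact isCellContent_column_nine i
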